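/- Let $\mu>0$ and $l_f,L_f,L_g,\rho_f,\rho_g\ge 0$. There is a constant $\bar C_\sigma\ge 0$, depending only on $\mu,l_f,L_f,L_g,\rho_f,\rho_g$, such that the following holds for all dimensions $d_x,d_y$, all $\bar\sigma\in\mathbb R$ and all $f,g:\mathbb R^{d_x}\times\mathbb R^{d_y}\to\mathbb R$. For $\sigma\ge 0$ put $g_\sigma=\sigma f+g$, $Y_\sigma^*(x)=\operatorname{argmin}_y g_\sigma(x,y)$, $Y^*(x)=\operatorname{argmin}_y g(x,y)$ and $\varphi(x)=\min_{y\in Y^*(x)}f(x,y)$. Assume that 1. for every $0\le\sigma\le\bar\sigma$ and every $x$, the function $h=g_\sigma(x,\cdot)$ attains its minimum $h^*$ and is $\mu$-Polyak–Łojasiewicz, i.e. $2\mu\,(h(y)-h^*)\le\|\nabla h(y)\|^2$ for all $y$; 2. $f$ is $l_f$-Lipschitz and differentiable with $L_f$-Lipschitz gradient, and $g$ is differentiable with $L_g$-Lipschitz gradient, jointly in $(x,y)$ and in the Euclidean norm; 3. $f$ and $g$ are twice differentiable, with $\rho_f$- respectively $\rho_g$-Lipschitz Hessians (in the operator norm),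 jointly in $(x,y)$. Let $0<\sigma\le\bar\sigma$ with $\sigma\rho_f\le\rho_g$ (that is, $\sigma\le\min\{\rho_g/\rho_f,\bar\sigma\}$ when $\rho_f>0$). Then, for every $x\in\mathbb R^{d_x}$, $Y^*(x)$ and $Y_\sigma^*(x)$ are non-empty, the minimum defining $\varphi(x)$ is attained, $\varphi$ is differentiable at $x$, and, for all points $\hat y,\hat z\in\mathbb R^{d_y}$ (regarded as approximate minimizers of $g_\sigma(x,\cdot)$ and $g(x,\cdot)$), the estimate $$\widehat\nabla\varphi(x,\hat y,\hat z)=\nabla_xf(x,\hat y)+\frac{\nabla_xg(x,\hat y)-\nabla_xg(x,\hat z)}{\sigma}$$ satisfies $$\bigl\|\nabla\varphi(x)-\widehat\nabla\varphi(x,\hat y,\hat z)\bigr\|\le\bar C_\sigma\,\sigma+\Bigl(L_f\operatorname{dist}(\hat y,Y_\sigma^*(x))+\frac{L_g}{\sigma}\operatorname{dist}(\hat y,Y_\sigma^*(x))+\frac{L_g}{\sigma}\operatorname{dist}(\hat z,Y^*(x))\Bigr),$$ where $\operatorname{dist}(y,S)=\inf_{s\in S}\|y-s\|$. -/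

import Mathlib

open scoped NNReal

noncomputable section

/-- The Euclidean space `ℝ^d`. -/
abbrev Euc (d : ℕ) : Type := EuclideanSpace ℝ (Fin d)

/-- The set of global minimizers of `h`. -/
def argminSet {E : Type*} (h : E → ℝ) : Set E := {y | ∀ y', h y ≤ h y'}

/-- `h` attains its minimum `h⋆` and `2 μ (h y - h⋆) ≤ ‖∇ h y‖ ^ 2` for all `y`. -/
def IsPL {d : ℕ} (μ : ℝ) (h : Euc d → ℝ) : Prop :=
  (argminSet h).Nonempty ∧ ∀ y, 2 * μ * (h y - ⨅ y', h y') ≤ ‖gradient h y‖ ^ 2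

/-- A function of two vector variables as a function on `ℝ^dx × ℝ^dy = ℝ^(dx + dy)`
with the Euclidean (not the sup) norm. -/
def joint {dx dy : ℕ} (f : Euc dx → Euc dy → ℝ) : WithLp 2 (Euc dx × Euc dy) → ℝ :=
  fun p => f p.fst p.snd

/-- `F` is differentiable and its gradient is `L`-Lipschitz. -/
def HasLipschitzGradient {E : Type*} [NormedAddCommGroup E] [InnerProductSpace ℝ E]
    [CompleteSpace E] (L : ℝ≥0) (F : E → ℝ) : Prop :=
  Differentiable ℝ F ∧ LipschitzWith L (gradient F)

/-- `F` is twice differentiable and its Hessian, the derivative of the gradient, is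
`ρ`-Lipschitz in the operator norm. -/
def HasLipschitzHessian {E : Type*} [NormedAddCommGroup E] [InnerProductSpace ℝ E]
    [CompleteSpace E] (ρ : ℝ≥0) (F : E → ℝ) : Prop :=
  Differentiable ℝ F ∧ Differentiable ℝ (gradient F) ∧
    LipschitzWith ρ (fderiv ℝ (gradient F))

/-- The penalty function `g_σ = σ f + g`. -/
def penalty {dx dy : ℕ} (f g : Euc dx → Euc dy → ℝ) (σ : ℝ) : Euc dx → Euc dy → ℝ :=
  fun x y => σ * f x y + g x y

/-- The lower-level solution set `Y⋆(x) = argmin_y g(x, y)`. -/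
def lowerSol {dx dy : ℕ} (g : Euc dx → Euc dy → ℝ) (x : Euc dx) : Set (Euc dy) :=
  argminSet (g x)

/-- The penalty solution set `Y_σ⋆(x) = argmin_y g_σ(x, y)`. -/
def penaltySol {dx dy : ℕ} (f g : Euc dx → Euc dy → ℝ) (σ : ℝ) (x : Euc dx) :
    Set (Euc dy) :=
  argminSet (penalty f g σ x)

/-- The hyper-objective `φ(x) = min_{y ∈ Y⋆(x)} f(x, y)`. -/
def hyperObj {dx dy : ℕ} (f g : Euc dx → Euc dy → ℝ) (x : Euc dx) : ℝ :=
  sInf (f x '' lowerSol g x)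

/-- The fully first-order hypergradient estimate
`∇ₓ f(x, ŷ) + (∇ₓ g(x, ŷ) - ∇ₓ g(x, ẑ)) / σ`. -/
def hyperGradEst {dx dy : ℕ} (f g : Euc dx → Euc dy → ℝ) (σ : ℝ) (x : Euc dx)
    (yhat zhat : Euc dy) : Euc dx :=
  gradient (fun x' => f x' yhat) x +
    σ⁻¹ • (gradient (fun x' => g x' yhat) x - gradient (fun x' => g x' zhat) x)

/-- The standing assumptions on the upper-level function `f` and the lower-level function `g`. -/
structure BilevelAssumption {dx dy : ℕ} (μ σbar : ℝ) (lf Lf Lg ρf ρg : ℝ≥0)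
    (f g : Euc dx → Euc dy → ℝ) : Prop where
  pl : ∀ σ : ℝ, 0 ≤ σ → σ ≤ σbar → ∀ x, IsPL μ (penalty f g σ x)
  lipschitz_f : LipschitzWith lf (joint f)
  gradient_f : HasLipschitzGradient Lf (joint f)
  gradient_g : HasLipschitzGradient Lg (joint g)
  hessian_f : HasLipschitzHessian ρf (joint f)
  hessian_g : HasLipschitzHessian ρg (joint g)

end

/-! Write `v_σ(x) = min_y g_σ(x, y)` and `q_σ = (v_σ - v_0) / σ`. The estimate is `∇q_σ(x)` with
exact minimizers replaced by `ŷ` and `ẑ`, which accounts for the distance terms. It remains to show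
`‖∇φ - ∇q_σ‖ = O(σ)`, without inverting a Hessian or assuming that minimizers are unique.

The PL inequality gives an error bound: some minimizer lies within `2/μ` times the gradient norm of
any given point. Hence minimizers can be chosen near a given one as `x` or `σ` changes, so Danskin's
formula `∇v_σ(x) = ∇ₓg_σ(x, y)` holds for every minimizer `y`, and `∇ₓg_σ(x, ·)` is constant on the
minimizers.

With `τ = σ/2`, `∇q_σ - ∇q_τ` is `σ⁻¹` times the second difference `∇v_{2τ} - 2∇v_τ + ∇v_0`.
Lipschitz Hessians make this `O(τ²)` (`norm_gradFst_second_difference_le`). Along `σ/2^k` the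
gradients are thus uniformly Cauchy with geometric steps; since `q_σ → φ` pointwise, the limit is
`∇φ`, at distance `O(σ)` from `∇q_σ`. -/

/-! ### Error bound from the PL inequality, and Danskin's theorem -/

/-- A function that decreases at rate at most `c` around `p` has a gradient of norm at most `c`
at `p`. -/
theorem HasGradientAt.norm_le_of_sub_le {E : Type*} [NormedAddCommGroup E]
    [InnerProductSpace ℝ E] [CompleteSpace E] {u : E → ℝ} {G p : E} {c : ℝ} (hc₀ : 0 ≤ c)
    (hu : HasGradientAt u G p) (hc : ∀ y, u p - c * ‖y - p‖ ≤ u y) : ‖G‖ ≤ c := by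
  have hline : HasDerivAt (fun t : ℝ => u (p + t • -G)) (-‖G‖ ^ 2) 0 := by
    have h1 : HasDerivAt (fun t : ℝ => p + t • -G) (-G) 0 := by
      simpa using ((hasDerivAt_id (0 : ℝ)).smul_const (-G)).const_add p
    have h2 : HasFDerivAt u (InnerProductSpace.toDual ℝ E G) (p + (0 : ℝ) • -G) := by
      simpa using hu.hasFDerivAt
    simpa [Function.comp_def] using h2.comp_hasDerivAt (0 : ℝ) h1
  have hslope : -(c * ‖G‖) ≤ -‖G‖ ^ 2 := by
    refine ge_of_tendsto hline.tendsto_slope_zero_right ?_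
    filter_upwards [self_mem_nhdsWithin] with t ht
    have ht : 0 < t := ht
    have h := hc (p + t • -G)
    rw [add_sub_cancel_left, norm_smul, norm_neg, Real.norm_of_nonneg ht.le] at h
    simp only [zero_add, zero_smul, add_zero, smul_eq_mul]
    rw [inv_mul_eq_div, le_div_iff₀ ht]
    linarith
  by_contra! hlt
  nlinarith [norm_nonneg G]

theorem iInf_eq_of_mem_argminSet {E : Type*} {h : E → ℝ} {p : E} (hp : p ∈ argminSet h) :
    ⨅ y, h y = h p := by
  have : Nonempty E := ⟨p⟩
  exact le_antisymm (ciInf_le ⟨h p, by rintro _ ⟨y, rfl⟩; exact hp y⟩ p) (le_ciInf hp)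

/-- The Łojasiewicz inequality implies the error bound. -/
theorem IsPL.exists_argmin_near {d : ℕ} {μ : ℝ} (hμ : 0 < μ) {h : Euc d → ℝ}
    (hd : Differentiable ℝ h) (hPL : IsPL μ h) (y₀ : Euc d) :
    ∃ p ∈ argminSet h, ‖p - y₀‖ ≤ 2 / μ * ‖gradient h y₀‖ := by
  obtain ⟨⟨y₁, hy₁⟩, hPL⟩ := hPL
  rw [iInf_eq_of_mem_argminSet hy₁] at hPL
  set m := h y₁
  set u : Euc d → ℝ := fun y => √(h y - m)
  -- By PL, `u` has slope at least `√(μ/2)` off the minimizers. As `c` is strictly smaller, a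
  -- minimizer of `u + c * dist · y₀` must already minimize `h`.
  set c := √μ / 2
  have hc : 0 < c := by positivity
  have hc2 : 4 * c ^ 2 = μ := by
    simp only [c, div_pow, Real.sq_sqrt hμ.le]; ring
  have hu2 : ∀ y, u y ^ 2 = h y - m := fun y => Real.sq_sqrt (sub_nonneg.2 (hy₁ y))
  have hu0 : ∀ y, 0 ≤ u y := fun y => Real.sqrt_nonneg _
  have hcont : Continuous u := (hd.continuous.sub continuous_const).sqrt
  obtain ⟨p, hp⟩ : ∃ p, ∀ y, u p + c * dist p y₀ ≤ u y + c * dist y y₀ := by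
    refine Continuous.exists_forall_le (by fun_prop) ?_
    refine Filter.tendsto_atTop_mono (fun y => le_add_of_nonneg_left (hu0 y)) ?_
    exact (tendsto_dist_right_cocompact_atTop y₀).const_mul_atTop hc
  have hpm : h p = m := by
    by_contra hne
    have hpos : 0 < u p := Real.sqrt_pos.2 (sub_pos.2 (lt_of_le_of_ne (hy₁ p) (Ne.symm hne)))
    have hgrad : HasGradientAt u ((1 / (2 * u p)) • gradient h p) p := by
      have := ((hd p).hasGradientAt.hasFDerivAt.sub_const m).sqrt
        (sub_pos.2 (lt_of_le_of_ne (hy₁ p) (Ne.symm hne))).ne'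
      rw [hasGradientAt_iff_hasFDerivAt, map_smul]
      exact this
    have hle : ‖(1 / (2 * u p)) • gradient h p‖ ≤ c := by
      refine hgrad.norm_le_of_sub_le hc.le fun y => ?_
      have h1 := hp y
      have h2 := dist_triangle y p y₀
      rw [dist_eq_norm y p] at h2
      nlinarith
    rw [norm_smul, Real.norm_of_nonneg (by positivity), one_div, inv_mul_eq_div,
      div_le_iff₀ (by positivity)] at hle
    have h3 := hPL p
    rw [← hu2 p] at h3
    have h4 : ‖gradient h p‖ ^ 2 ≤ (c * (2 * u p)) ^ 2 := by gcongr
    have h5 : 0 < μ * u p ^ 2 := by positivity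
    nlinarith
  refine ⟨p, fun y => hpm ▸ hy₁ y, ?_⟩
  have h1 : c * ‖p - y₀‖ ≤ u y₀ := by
    have := hp y₀
    rw [dist_self, dist_eq_norm] at this
    have := hu0 p
    linarith
  have h2 := hPL y₀
  rw [← hu2] at h2
  rw [div_mul_eq_mul_div, le_div_iff₀ hμ]
  refine le_of_sq_le_sq ?_ (by positivity)
  have h3 : (c * ‖p - y₀‖) ^ 2 ≤ u y₀ ^ 2 := by gcongr
  have h4 : 0 ≤ μ * (u y₀ ^ 2 - (c * ‖p - y₀‖) ^ 2) := by
    have := sub_nonneg.2 h3; positivity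
  have h5 : μ ^ 2 * ‖p - y₀‖ ^ 2 = 4 * μ * (c * ‖p - y₀‖) ^ 2 := by rw [← hc2]; ring
  nlinarith [sq_nonneg ‖gradient h y₀‖]

/-- The value function of a differentiable function with a locally Lipschitz choice of minimizers
is differentiable. -/
theorem hasGradientAt_iInf {E F : Type*} [NormedAddCommGroup E]
    [InnerProductSpace ℝ E] [CompleteSpace E] [NormedAddCommGroup F]
    [InnerProductSpace ℝ F] [CompleteSpace F] {h : WithLp 2 (E × F) → ℝ} {x : E} {y : F} {K : ℝ}
    {G : WithLp 2 (E × F)} (hh : HasGradientAt h G (WithLp.toLp 2 (x, y)))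
    (hy : ∀ y', h (WithLp.toLp 2 (x, y)) ≤ h (WithLp.toLp 2 (x, y')))
    (hG : G.snd = 0)
    (hsel : ∀ x', ∃ y', (∀ y'', h (WithLp.toLp 2 (x', y')) ≤ h (WithLp.toLp 2 (x', y''))) ∧
      ‖y' - y‖ ≤ K * ‖x' - x‖) :
    HasGradientAt (fun x' => ⨅ y', h (WithLp.toLp 2 (x', y'))) G.fst x := by
  choose s hs hsK using hsel
  have hv : ∀ x', ⨅ y', h (WithLp.toLp 2 (x', y')) = h (WithLp.toLp 2 (x', s x')) := fun x' =>
    iInf_eq_of_mem_argminSet (h := fun y' => h (WithLp.toLp 2 (x', y'))) (hs x')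
  have hvx : h (WithLp.toLp 2 (x, s x)) = h (WithLp.toLp 2 (x, y)) :=
    le_antisymm (hs x y) (hy _)
  rw [hasGradientAt_iff_isLittleO] at hh ⊢
  have hO : (fun x' => WithLp.toLp 2 (x', s x') - WithLp.toLp 2 (x, y)) =O[nhds x]
      fun x' => x' - x := by
    refine Asymptotics.IsBigO.of_bound (1 + K) (Filter.Eventually.of_forall fun x' => ?_)
    have : WithLp.toLp 2 (x', s x') - WithLp.toLp 2 (x, y) =
        WithLp.toLp 2 (x' - x, 0) + WithLp.toLp 2 (0, s x' - y) := by
      apply WithLp.ofLp_injective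
      ext <;> simp
    rw [this, add_mul, one_mul]
    refine (norm_add_le _ _).trans (add_le_add ?_ ?_)
    · simp
    · simpa using hsK x'
  have ht : Filter.Tendsto (fun x' => WithLp.toLp 2 (x', s x')) (nhds x)
      (nhds (WithLp.toLp 2 (x, y))) :=
    tendsto_sub_nhds_zero_iff.1
      (hO.trans_tendsto (tendsto_sub_nhds_zero_iff.2 Filter.tendsto_id))
  simp only [hv, hvx]
  -- The selection moves by `O(‖x' - x‖)`, and its first-order contribution vanishes because `G.snd
  -- = 0`.
  refine ((hh.comp_tendsto ht).trans_isBigO hO).congr_left fun x' => ?_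
  simp [WithLp.prod_inner_apply, hG]

/-! ### Partial gradients of functions on the product -/

theorem HasGradientAt.fst_of_joint {dx dy : ℕ} {f : Euc dx → Euc dy → ℝ} {x : Euc dx} {y : Euc dy}
    {G : WithLp 2 (Euc dx × Euc dy)} (h : HasGradientAt (joint f) G (WithLp.toLp 2 (x, y))) :
    HasGradientAt (fun x' => f x' y) G.fst x := by
  have hl : HasFDerivAt (fun x' : Euc dx => WithLp.toLp 2 (x', y))
      ((WithLp.prodContinuousLinearEquiv 2 ℝ (Euc dx) (Euc dy)).symm.toContinuousLinearMap ∘L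
        ContinuousLinearMap.inl ℝ (Euc dx) (Euc dy)) x :=
    (WithLp.prodContinuousLinearEquiv 2 ℝ (Euc dx) (Euc dy)).symm.hasFDerivAt.comp x
      (hasFDerivAt_prodMk_left x y)
  rw [hasGradientAt_iff_hasFDerivAt]
  refine (h.hasFDerivAt.comp x hl).congr_fderiv ?_
  ext v
  simp [WithLp.prod_inner_apply]

theorem HasGradientAt.snd_of_joint {dx dy : ℕ} {f : Euc dx → Euc dy → ℝ} {x : Euc dx} {y : Euc dy}
    {G : WithLp 2 (Euc dx × Euc dy)} (h : HasGradientAt (joint f) G (WithLp.toLp 2 (x, y))) :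
    HasGradientAt (f x) G.snd y := by
  have hl : HasFDerivAt (fun y' : Euc dy => WithLp.toLp 2 (x, y'))
      ((WithLp.prodContinuousLinearEquiv 2 ℝ (Euc dx) (Euc dy)).symm.toContinuousLinearMap ∘L
        ContinuousLinearMap.inr ℝ (Euc dx) (Euc dy)) y :=
    (WithLp.prodContinuousLinearEquiv 2 ℝ (Euc dx) (Euc dy)).symm.hasFDerivAt.comp y
      (hasFDerivAt_prodMk_right x y)
  rw [hasGradientAt_iff_hasFDerivAt]
  refine (h.hasFDerivAt.comp y hl).congr_fderiv ?_
  ext v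
  simp [WithLp.prod_inner_apply]

/-- The parallelogram defect of a map with Lipschitz derivative is bilinearly small. -/
theorem norm_parallelogram_defect_le {E F : Type*} [NormedAddCommGroup E] [NormedSpace ℝ E]
    [NormedAddCommGroup F] [NormedSpace ℝ F] {G : E → F} {ρ : ℝ≥0} (hG : Differentiable ℝ G)
    (hL : LipschitzWith ρ (fderiv ℝ G)) (a u v : E) :
    ‖G (a + u + v) - G (a + u) - G (a + v) + G a‖ ≤ ρ * ‖u‖ * ‖v‖ := by
  have hd : ∀ b, HasFDerivAt (fun b => G (b + u) - G b) (fderiv ℝ G (b + u) - fderiv ℝ G b) b :=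
    fun b => ((hasFDerivAt_comp_add_right u).2 (hG (b + u)).hasFDerivAt).sub (hG b).hasFDerivAt
  -- Mean value inequality for `b ↦ G (b + u) - G b` between `a` and `a + v`.
  have h := Convex.norm_image_sub_le_of_norm_hasFDerivWithin_le (C := ρ * ‖u‖)
    (fun b _ => (hd b).hasFDerivWithinAt)
    (fun b _ => by simpa using hL.norm_sub_le (b + u) b) convex_univ
    (Set.mem_univ a) (Set.mem_univ (a + v))
  rw [add_sub_cancel_left] at h
  convert h using 2
  rw [add_right_comm]
  abel

/-- The partial gradient in the first variable. -/
noncomputable def gradFst {dx dy : ℕ} (f : Euc dx → Euc dy → ℝ) (x : Euc dx) (y : Euc dy) : Euc dx :=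
  gradient (fun x' => f x' y) x

/-- The partial gradient in the second variable. -/
noncomputable def gradSnd {dx dy : ℕ} (f : Euc dx → Euc dy → ℝ) (x : Euc dx) (y : Euc dy) : Euc dy :=
  gradient (f x) y

section Joint

variable {dx dy : ℕ} {f g : Euc dx → Euc dy → ℝ} {l L ρ : ℝ≥0}

theorem gradFst_eq (hf : Differentiable ℝ (joint f)) (x : Euc dx) (y : Euc dy) :
    gradFst f x y = (gradient (joint f) (WithLp.toLp 2 (x, y))).fst :=
  (hf _).hasGradientAt.fst_of_joint.gradient

theorem gradSnd_eq (hf : Differentiable ℝ (joint f)) (x : Euc dx) (y : Euc dy) :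
    gradSnd f x y = (gradient (joint f) (WithLp.toLp 2 (x, y))).snd :=
  (hf _).hasGradientAt.snd_of_joint.gradient

theorem differentiable_of_joint (hf : Differentiable ℝ (joint f)) (x : Euc dx) :
    Differentiable ℝ (f x) :=
  fun y => (hf (WithLp.toLp 2 (x, y))).hasGradientAt.snd_of_joint.differentiableAt

theorem toLp_snd_sub (x : Euc dx) (y y' : Euc dy) :
    (WithLp.toLp 2 (x, y) - WithLp.toLp 2 (x, y') : WithLp 2 (Euc dx × Euc dy)) =
      WithLp.toLp 2 (0, y - y') := by
  apply WithLp.ofLp_injective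
  ext <;> simp

theorem toLp_fst_sub (x x' : Euc dx) (y : Euc dy) :
    (WithLp.toLp 2 (x, y) - WithLp.toLp 2 (x', y) : WithLp 2 (Euc dx × Euc dy)) =
      WithLp.toLp 2 (x - x', 0) := by
  apply WithLp.ofLp_injective
  ext <;> simp

theorem HasLipschitzGradient.gradFst_sub_le (hf : HasLipschitzGradient L (joint f)) (x : Euc dx)
    (y y' : Euc dy) : ‖gradFst f x y - gradFst f x y'‖ ≤ L * ‖y - y'‖ := by
  rw [gradFst_eq hf.1, gradFst_eq hf.1, ← WithLp.sub_fst]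
  refine (WithLp.norm_fst_le _ _).trans ((hf.2.norm_sub_le _ _).trans_eq ?_)
  simp [toLp_snd_sub]

theorem HasLipschitzGradient.gradSnd_sub_le (hf : HasLipschitzGradient L (joint f)) (x : Euc dx)
    (y y' : Euc dy) : ‖gradSnd f x y - gradSnd f x y'‖ ≤ L * ‖y - y'‖ := by
  rw [gradSnd_eq hf.1, gradSnd_eq hf.1, ← WithLp.sub_snd]
  refine (WithLp.norm_snd_le _ _).trans ((hf.2.norm_sub_le _ _).trans_eq ?_)
  simp [toLp_snd_sub]

theorem HasLipschitzGradient.gradSnd_sub_le' (hf : HasLipschitzGradient L (joint f)) (x x' : Euc dx)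
    (y : Euc dy) : ‖gradSnd f x y - gradSnd f x' y‖ ≤ L * ‖x - x'‖ := by
  rw [gradSnd_eq hf.1, gradSnd_eq hf.1, ← WithLp.sub_snd]
  refine (WithLp.norm_snd_le _ _).trans ((hf.2.norm_sub_le _ _).trans_eq ?_)
  simp [toLp_fst_sub]

theorem HasLipschitzHessian.norm_gradient_defect_le (hf : HasLipschitzHessian ρ (joint f))
    (x : Euc dx) (y u v : Euc dy) :
    ‖gradient (joint f) (WithLp.toLp 2 (x, y + u + v)) -
        gradient (joint f) (WithLp.toLp 2 (x, y + u)) -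
        gradient (joint f) (WithLp.toLp 2 (x, y + v)) +
        gradient (joint f) (WithLp.toLp 2 (x, y))‖ ≤ ρ * ‖u‖ * ‖v‖ := by
  have h := norm_parallelogram_defect_le hf.2.1 hf.2.2 (WithLp.toLp 2 (x, y))
    (WithLp.toLp 2 (0, u)) (WithLp.toLp 2 (0, v))
  simp only [← WithLp.toLp_add, Prod.mk_add_mk, add_zero] at h
  simpa using h

theorem HasLipschitzHessian.gradFst_defect_le (hf : HasLipschitzHessian ρ (joint f))
    (x : Euc dx) (y u v : Euc dy) :
    ‖gradFst f x (y + u + v) - gradFst f x (y + u) - gradFst f x (y + v) + gradFst f x y‖ ≤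
      ρ * ‖u‖ * ‖v‖ := by
  simp only [gradFst_eq hf.1, ← WithLp.sub_fst, ← WithLp.add_fst]
  exact (WithLp.norm_fst_le _ _).trans (hf.norm_gradient_defect_le x y u v)

theorem HasLipschitzHessian.gradSnd_defect_le (hf : HasLipschitzHessian ρ (joint f))
    (x : Euc dx) (y u v : Euc dy) :
    ‖gradSnd f x (y + u + v) - gradSnd f x (y + u) - gradSnd f x (y + v) + gradSnd f x y‖ ≤
      ρ * ‖u‖ * ‖v‖ := by
  simp only [gradSnd_eq hf.1, ← WithLp.sub_snd, ← WithLp.add_snd]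
  exact (WithLp.norm_snd_le _ _).trans (hf.norm_gradient_defect_le x y u v)

theorem LipschitzWith.norm_gradient_le {E : Type*} [NormedAddCommGroup E] [InnerProductSpace ℝ E]
    [CompleteSpace E] {F : E → ℝ} (hF : LipschitzWith l F) (p : E) : ‖gradient F p‖ ≤ l := by
  simpa [gradient] using norm_fderiv_le_of_lipschitz ℝ hF (x₀ := p)

theorem norm_gradFst_le (hd : Differentiable ℝ (joint f)) (hf : LipschitzWith l (joint f))
    (x : Euc dx) (y : Euc dy) : ‖gradFst f x y‖ ≤ l := by
  rw [gradFst_eq hd]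
  exact (WithLp.norm_fst_le _ _).trans (hf.norm_gradient_le _)

theorem norm_gradSnd_le (hd : Differentiable ℝ (joint f)) (hf : LipschitzWith l (joint f))
    (x : Euc dx) (y : Euc dy) : ‖gradSnd f x y‖ ≤ l := by
  rw [gradSnd_eq hd]
  exact (WithLp.norm_snd_le _ _).trans (hf.norm_gradient_le _)

theorem abs_sub_le_of_lipschitz_joint (hf : LipschitzWith l (joint f)) (x : Euc dx)
    (y y' : Euc dy) : |f x y - f x y'| ≤ l * ‖y - y'‖ := by
  have h := hf.norm_sub_le (WithLp.toLp 2 (x, y)) (WithLp.toLp 2 (x, y'))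
  rw [toLp_snd_sub] at h
  simpa [joint] using h

theorem differentiable_joint_penalty (hf : Differentiable ℝ (joint f))
    (hg : Differentiable ℝ (joint g)) (σ : ℝ) : Differentiable ℝ (joint (penalty f g σ)) :=
  (hf.const_smul σ).add hg

theorem gradient_joint_penalty (hf : Differentiable ℝ (joint f))
    (hg : Differentiable ℝ (joint g)) (σ : ℝ) (p : WithLp 2 (Euc dx × Euc dy)) :
    gradient (joint (penalty f g σ)) p = σ • gradient (joint f) p + gradient (joint g) p := by
  refine HasGradientAt.gradient ?_
  rw [hasGradientAt_iff_hasFDerivAt, map_add, map_smul]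
  exact ((hf p).hasGradientAt.hasFDerivAt.const_smul σ).add (hg p).hasGradientAt.hasFDerivAt

theorem gradFst_penalty (hf : Differentiable ℝ (joint f)) (hg : Differentiable ℝ (joint g)) (σ : ℝ)
    (x : Euc dx) (y : Euc dy) :
    gradFst (penalty f g σ) x y = σ • gradFst f x y + gradFst g x y := by
  simp [gradFst_eq, differentiable_joint_penalty, gradient_joint_penalty, hf, hg]

theorem gradSnd_penalty (hf : Differentiable ℝ (joint f)) (hg : Differentiable ℝ (joint g)) (σ : ℝ)
    (x : Euc dx) (y : Euc dy) :
    gradSnd (penalty f g σ) x y = σ • gradSnd f x y + gradSnd g x y := by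
  simp [gradSnd_eq, differentiable_joint_penalty, gradient_joint_penalty, hf, hg]

end Joint

/-! ### Penalty minimizers, values and difference quotients -/

/-- The value function `x ↦ inf_y g_σ(x, y)` of the penalty problem. -/
noncomputable def penaltyVal {dx dy : ℕ} (f g : Euc dx → Euc dy → ℝ) (σ : ℝ) (x : Euc dx) : ℝ :=
  ⨅ y, penalty f g σ x y

/-- The difference quotient of the penalty value in the penalty parameter, at `0`. -/
noncomputable def penaltyQuot {dx dy : ℕ} (f g : Euc dx → Euc dy → ℝ) (σ : ℝ) (x : Euc dx) : ℝ :=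
  σ⁻¹ * (penaltyVal f g σ x - penaltyVal f g 0 x)

/-- The bound on the gradient of the penalty difference quotient. -/
noncomputable def quotBound (μ : ℝ) (lf Lg : ℝ≥0) : ℝ := lf + Lg * (2 / μ * lf)

/-- The rate at which the gradient of the penalty difference quotient varies with the penalty
parameter. -/
noncomputable def quotRate (μ : ℝ) (lf Lf Lg ρf ρg : ℝ≥0) : ℝ :=
  (1 + (Lf + Lg) * (2 / μ)) * ((ρf + ρg) * (2 / μ * lf) ^ 2 + 2 * Lf * (2 / μ * lf)) +
    2 * quotBound μ lf Lg

section Bilevel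

variable {dx dy : ℕ} {f g : Euc dx → Euc dy → ℝ} {μ σbar σ τ : ℝ} {lf Lf Lg ρf ρg : ℝ≥0}
  {x : Euc dx} {y z : Euc dy}

theorem penaltySol_zero (f g : Euc dx → Euc dy → ℝ) (x : Euc dx) :
    penaltySol f g 0 x = lowerSol g x := by
  have : penalty f g 0 x = g x := by ext; simp [penalty]
  rw [penaltySol, this, lowerSol]

theorem gradSnd_eq_zero {h : Euc dx → Euc dy → ℝ} (hy : y ∈ argminSet (h x)) :
    gradSnd h x y = 0 := by
  have : IsLocalMin (h x) y := Filter.Eventually.of_forall hy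
  simp [gradSnd, gradient, this.fderiv_eq_zero]

theorem penaltyVal_eq (hy : y ∈ penaltySol f g σ x) : penaltyVal f g σ x = penalty f g σ x y :=
  iInf_eq_of_mem_argminSet hy

theorem isClosed_argminSet {E : Type*} [TopologicalSpace E] {h : E → ℝ} (hc : Continuous h) :
    IsClosed (argminSet h) := by
  have : argminSet h = ⋂ y', {y | h y ≤ h y'} := by ext; simp [argminSet]
  rw [this]
  exact isClosed_iInter fun y' => isClosed_le hc continuous_const

theorem differentiable_penalty (hf : Differentiable ℝ (joint f)) (hg : Differentiable ℝ (joint g))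
    (σ : ℝ) (x : Euc dx) : Differentiable ℝ (penalty f g σ x) :=
  differentiable_of_joint (differentiable_joint_penalty hf hg σ) x

namespace BilevelAssumption

variable (A : BilevelAssumption μ σbar lf Lf Lg ρf ρg f g)
include A

theorem penaltySol_nonempty (h0 : 0 ≤ σ) (hσ : σ ≤ σbar) : (penaltySol f g σ x).Nonempty :=
  (A.pl σ h0 hσ x).1

theorem exists_penaltySol_near (hμ : 0 < μ) (h0 : 0 ≤ σ) (hσ : σ ≤ σbar) (x : Euc dx)
    (y : Euc dy) :
    ∃ p ∈ penaltySol f g σ x, ‖p - y‖ ≤ 2 / μ * ‖gradSnd (penalty f g σ) x y‖ :=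
  (A.pl σ h0 hσ x).exists_argmin_near hμ
    (differentiable_penalty A.gradient_f.1 A.gradient_g.1 σ x) y

/-- Stationarity at parameter `τ` leaves only the change of the coefficient of `f`. -/
theorem gradSnd_penalty_eq (hy : y ∈ penaltySol f g τ x) :
    gradSnd (penalty f g σ) x y = (σ - τ) • gradSnd f x y := by
  have h : gradSnd (penalty f g τ) x y = 0 := gradSnd_eq_zero hy
  rw [gradSnd_penalty A.gradient_f.1 A.gradient_g.1] at h ⊢
  rw [eq_neg_of_add_eq_zero_right h]
  module

theorem exists_penaltySol_near_penaltySol (hμ : 0 < μ) (h0 : 0 ≤ σ) (hσ : σ ≤ σbar)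
    (hy : y ∈ penaltySol f g τ x) :
    ∃ p ∈ penaltySol f g σ x, ‖p - y‖ ≤ 2 / μ * lf * |σ - τ| := by
  obtain ⟨p, hp, hpy⟩ := A.exists_penaltySol_near hμ h0 hσ x y
  refine ⟨p, hp, hpy.trans ?_⟩
  rw [A.gradSnd_penalty_eq hy, norm_smul, Real.norm_eq_abs, mul_assoc, mul_comm (lf : ℝ)]
  gcongr
  exact norm_gradSnd_le A.gradient_f.1 A.lipschitz_f x y

theorem gradFst_penalty_sub_le (h0 : 0 ≤ σ) (x : Euc dx) (y y' : Euc dy) :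
    ‖gradFst (penalty f g σ) x y - gradFst (penalty f g σ) x y'‖ ≤ (σ * Lf + Lg) * ‖y - y'‖ := by
  rw [gradFst_penalty A.gradient_f.1 A.gradient_g.1, gradFst_penalty A.gradient_f.1 A.gradient_g.1,
    add_sub_add_comm, ← smul_sub, add_mul, mul_assoc]
  refine norm_add_le_of_le ?_ (A.gradient_g.gradFst_sub_le x y y')
  rw [norm_smul, Real.norm_of_nonneg h0]
  gcongr
  exact A.gradient_f.gradFst_sub_le x y y'

theorem gradSnd_penalty_sub_le' (h0 : 0 ≤ σ) (x x' : Euc dx) (y : Euc dy) :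
    ‖gradSnd (penalty f g σ) x y - gradSnd (penalty f g σ) x' y‖ ≤ (σ * Lf + Lg) * ‖x - x'‖ := by
  rw [gradSnd_penalty A.gradient_f.1 A.gradient_g.1, gradSnd_penalty A.gradient_f.1 A.gradient_g.1,
    add_sub_add_comm, ← smul_sub, add_mul, mul_assoc]
  refine norm_add_le_of_le ?_ (A.gradient_g.gradSnd_sub_le' x x' y)
  rw [norm_smul, Real.norm_of_nonneg h0]
  gcongr
  exact A.gradient_f.gradSnd_sub_le' x x' y

theorem gradFst_penalty_defect_le (h0 : 0 ≤ σ) (x : Euc dx) (y u v : Euc dy) :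
    ‖gradFst (penalty f g σ) x (y + u + v) - gradFst (penalty f g σ) x (y + u) -
        gradFst (penalty f g σ) x (y + v) + gradFst (penalty f g σ) x y‖ ≤
      (σ * ρf + ρg) * ‖u‖ * ‖v‖ := by
  simp only [gradFst_penalty A.gradient_f.1 A.gradient_g.1]
  have hf := A.hessian_f.gradFst_defect_le x y u v
  have hg := A.hessian_g.gradFst_defect_le x y u v
  calc _ = ‖σ • (gradFst f x (y + u + v) - gradFst f x (y + u) - gradFst f x (y + v) +
          gradFst f x y) + (gradFst g x (y + u + v) - gradFst g x (y + u) - gradFst g x (y + v) +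
          gradFst g x y)‖ := by congr 1; module
    _ ≤ σ * (ρf * ‖u‖ * ‖v‖) + ρg * ‖u‖ * ‖v‖ := by
      refine norm_add_le_of_le ?_ hg
      rw [norm_smul, Real.norm_of_nonneg h0]
      gcongr
    _ = _ := by ring

theorem gradSnd_penalty_defect_le (h0 : 0 ≤ σ) (x : Euc dx) (y u v : Euc dy) :
    ‖gradSnd (penalty f g σ) x (y + u + v) - gradSnd (penalty f g σ) x (y + u) -
        gradSnd (penalty f g σ) x (y + v) + gradSnd (penalty f g σ) x y‖ ≤
      (σ * ρf + ρg) * ‖u‖ * ‖v‖ := by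
  simp only [gradSnd_penalty A.gradient_f.1 A.gradient_g.1]
  have hf := A.hessian_f.gradSnd_defect_le x y u v
  have hg := A.hessian_g.gradSnd_defect_le x y u v
  calc _ = ‖σ • (gradSnd f x (y + u + v) - gradSnd f x (y + u) - gradSnd f x (y + v) +
          gradSnd f x y) + (gradSnd g x (y + u + v) - gradSnd g x (y + u) - gradSnd g x (y + v) +
          gradSnd g x y)‖ := by congr 1; module
    _ ≤ σ * (ρf * ‖u‖ * ‖v‖) + ρg * ‖u‖ * ‖v‖ := by
      refine norm_add_le_of_le ?_ hg
      rw [norm_smul, Real.norm_of_nonneg h0]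
      gcongr
    _ = _ := by ring

/-- Danskin's theorem for the penalty problem. -/
theorem hasGradientAt_penaltyVal (hμ : 0 < μ) (h0 : 0 ≤ σ) (hσ : σ ≤ σbar)
    (hy : y ∈ penaltySol f g σ x) :
    HasGradientAt (penaltyVal f g σ) (gradFst (penalty f g σ) x y) x := by
  have hd := differentiable_joint_penalty A.gradient_f.1 A.gradient_g.1 σ
  rw [gradFst_eq hd]
  refine hasGradientAt_iInf (h := joint (penalty f g σ)) (y := y)
    (K := 2 / μ * (σ * Lf + Lg)) (hd _).hasGradientAt hy ?_ fun x' => ?_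
  · rw [← gradSnd_eq hd]
    exact gradSnd_eq_zero hy
  · obtain ⟨p, hp, hpy⟩ := A.exists_penaltySol_near hμ h0 hσ x' y
    refine ⟨p, hp, hpy.trans ?_⟩
    -- The gradient in `y` vanishes at `(x, y)`, so at `(x', y)` it is `O(‖x' - x‖)`, and the error
    -- bound applies there.
    have h := A.gradSnd_penalty_sub_le' h0 x' x y
    rw [gradSnd_eq_zero (h := penalty f g σ) hy, sub_zero] at h
    rw [mul_assoc]
    gcongr

/-- Both sides are the gradient of the same value function. This stands in for uniqueness of the
minimizer. -/
theorem gradFst_penalty_eq (hμ : 0 < μ) (h0 : 0 ≤ σ) (hσ : σ ≤ σbar)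
    (hy : y ∈ penaltySol f g σ x) (hz : z ∈ penaltySol f g σ x) :
    gradFst (penalty f g σ) x y = gradFst (penalty f g σ) x z :=
  (A.hasGradientAt_penaltyVal hμ h0 hσ hy).unique (A.hasGradientAt_penaltyVal hμ h0 hσ hz)

theorem hasGradientAt_penaltyQuot (hμ : 0 < μ) (h0 : 0 < σ) (hσ : σ ≤ σbar)
    (hy : y ∈ penaltySol f g σ x) (hz : z ∈ lowerSol g x) :
    HasGradientAt (penaltyQuot f g σ)
      (gradFst f x y + σ⁻¹ • (gradFst g x y - gradFst g x z)) x := by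
  rw [← penaltySol_zero f g] at hz
  have hy' := (A.hasGradientAt_penaltyVal hμ h0.le hσ hy).hasFDerivAt
  have hz' := (A.hasGradientAt_penaltyVal hμ le_rfl (h0.le.trans hσ) hz).hasFDerivAt
  rw [hasGradientAt_iff_hasFDerivAt]
  refine ((hy'.sub hz').const_mul σ⁻¹).congr_fderiv ?_
  have hG : gradFst f x y + σ⁻¹ • (gradFst g x y - gradFst g x z) =
      σ⁻¹ • (gradFst (penalty f g σ) x y - gradFst (penalty f g 0) x z) := by
    rw [gradFst_penalty A.gradient_f.1 A.gradient_g.1,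
      gradFst_penalty A.gradient_f.1 A.gradient_g.1]
    match_scalars <;> simp [h0.ne']
  rw [hG, map_smulₛₗ, map_sub]
  rfl

theorem norm_gradient_penaltyQuot_le (hμ : 0 < μ) (h0 : 0 < σ) (hσ : σ ≤ σbar) (x : Euc dx) :
    ‖gradient (penaltyQuot f g σ) x‖ ≤ quotBound μ lf Lg := by
  obtain ⟨y, hy⟩ := A.penaltySol_nonempty (x := x) h0.le hσ
  obtain ⟨z, hz, hzy⟩ := A.exists_penaltySol_near_penaltySol hμ le_rfl (h0.le.trans hσ) hy
  rw [penaltySol_zero] at hz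
  rw [(A.hasGradientAt_penaltyQuot hμ h0 hσ hy hz).gradient]
  refine norm_add_le_of_le (norm_gradFst_le A.gradient_f.1 A.lipschitz_f x y) ?_
  rw [norm_smul, norm_inv, Real.norm_of_nonneg h0.le, inv_mul_eq_div, div_le_iff₀ h0]
  refine (A.gradient_g.gradFst_sub_le x y z).trans ?_
  rw [norm_sub_rev, mul_assoc]
  gcongr
  rwa [zero_sub, abs_neg, abs_of_pos h0] at hzy

/-! ### Second difference of the value gradients in the penalty parameter -/

/-- The fourth vertex `y + u + v` of the parallelogram on `y`, `yp`, `ym` is almost stationary for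
`g_τ`, hence close to a minimizer, where `∇ₓg_τ` has the same value as at `y`. The parallelogram
bound for `∇ₓg_τ` then controls the second difference. With `e = O(τ)` everything is `O(τ²)`. -/
theorem norm_gradFst_second_difference_le (hμ : 0 < μ) (h0 : 0 < τ) (h1 : τ ≤ 1)
    (hτ : 2 * τ ≤ σbar) {yp ym : Euc dy} (hy : y ∈ penaltySol f g τ x)
    (hyp : yp ∈ penaltySol f g (2 * τ) x) (hym : ym ∈ penaltySol f g 0 x) {e : ℝ}
    (hep : ‖yp - y‖ ≤ e) (hem : ‖ym - y‖ ≤ e) :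
    ‖gradFst (penalty f g (2 * τ)) x yp - gradFst (penalty f g τ) x y -
        gradFst (penalty f g τ) x y + gradFst (penalty f g 0) x ym‖ ≤
      (1 + (Lf + Lg) * (2 / μ)) * ((ρf + ρg) * e ^ 2 + 2 * Lf * τ * e) := by
  have hdf := A.gradient_f.1
  have hdg := A.gradient_g.1
  have he : 0 ≤ e := (norm_nonneg _).trans hep
  set u := yp - y with hu
  set v := ym - y with hv
  have hyu : y + u = yp := by simp [hu]
  have hyv : y + v = ym := by simp [hv]
  have hpm : ‖yp - ym‖ ≤ 2 * e := by
    have : yp - ym = u - v := by simp [hu, hv]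
    rw [this]
    linarith [norm_sub_le u v]
  have hρ : (τ * ρf + ρg) * ‖u‖ * ‖v‖ ≤ (ρf + ρg) * e ^ 2 := by
    rw [mul_assoc, sq]
    gcongr
    exact mul_le_of_le_one_left ρf.2 h1
  -- At `yp` and `ym` the gradients of `g_τ` are `-τ∇f` and `+τ∇f`, so they cancel up to `τ` times a
  -- difference of `∇f`.
  have hS : ‖gradSnd (penalty f g τ) x (y + u + v)‖ ≤ (ρf + ρg) * e ^ 2 + 2 * Lf * τ * e := by
    have hdef := A.gradSnd_penalty_defect_le h0.le x y u v
    rw [hyu, hyv, gradSnd_eq_zero (h := penalty f g τ) hy, A.gradSnd_penalty_eq hyp,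
      A.gradSnd_penalty_eq hym] at hdef
    rw [hyu]
    calc _ = ‖(gradSnd (penalty f g τ) x (yp + v) - (τ - 2 * τ) • gradSnd f x yp -
          (τ - 0) • gradSnd f x ym + 0) + -(τ • (gradSnd f x yp - gradSnd f x ym))‖ := by
          congr 1; module
      _ ≤ _ := by
        refine norm_add_le_of_le (hdef.trans hρ) ?_
        rw [norm_neg, norm_smul, Real.norm_of_nonneg h0.le]
        have := A.gradient_f.gradSnd_sub_le x yp ym
        calc _ ≤ τ * (Lf * (2 * e)) := by gcongr; exact this.trans (by gcongr)
          _ = _ := by ring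
  set B := (ρf + ρg) * e ^ 2 + 2 * Lf * τ * e
  obtain ⟨p, hp, hpq⟩ := A.exists_penaltySol_near hμ h0.le (by linarith) x (y + u + v)
  have hX : ‖gradFst (penalty f g τ) x (y + u + v) - gradFst (penalty f g τ) x y‖ ≤
      (Lf + Lg) * (2 / μ) * B := by
    rw [A.gradFst_penalty_eq hμ h0.le (by linarith) hy hp]
    refine (A.gradFst_penalty_sub_le h0.le x _ _).trans ?_
    rw [norm_sub_rev, mul_assoc]
    have hL : τ * Lf + Lg ≤ Lf + Lg := by
      gcongr
      exact mul_le_of_le_one_left Lf.2 h1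
    have hK : 2 / μ * ‖gradSnd (penalty f g τ) x (y + u + v)‖ ≤ 2 / μ * B := by gcongr
    gcongr
    exact hpq.trans hK
  have hdef := (A.gradFst_penalty_defect_le h0.le x y u v).trans hρ
  rw [hyu, hyv] at hdef
  rw [hyu] at hX
  have hf : ‖τ • (gradFst f x yp - gradFst f x ym)‖ ≤ 2 * Lf * τ * e := by
    rw [norm_smul, Real.norm_of_nonneg h0.le]
    have := A.gradient_f.gradFst_sub_le x yp ym
    calc _ ≤ τ * (Lf * (2 * e)) := by gcongr; exact this.trans (by gcongr)
      _ = _ := by ring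
  -- Since `g_{2τ} = g_τ + τf` and `g_0 = g_τ - τf`, passing to the common parameter `τ` costs
  -- `τ(∇ₓf(yp) - ∇ₓf(ym))`.
  set P := gradFst (penalty f g τ) x (yp + v)
  calc _ = ‖(P - gradFst (penalty f g τ) x y) +
        (-(P - gradFst (penalty f g τ) x yp - gradFst (penalty f g τ) x ym +
          gradFst (penalty f g τ) x y) + τ • (gradFst f x yp - gradFst f x ym))‖ := by
        simp only [gradFst_penalty hdf hdg]
        congr 1; module
    _ ≤ (Lf + Lg) * (2 / μ) * B + B := by
        refine norm_add_le_of_le hX (norm_add_le_of_le ?_ hf)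
        rwa [norm_neg]
    _ = _ := by ring

theorem norm_gradient_penaltyQuot_sub_le (hμ : 0 < μ) (h0 : 0 < σ) (hσ : σ ≤ σbar) (x : Euc dx) :
    ‖gradient (penaltyQuot f g σ) x - gradient (penaltyQuot f g (σ / 2)) x‖ ≤
      quotRate μ lf Lf Lg ρf ρg * σ := by
  have hM : 0 ≤ quotBound μ lf Lg := by unfold quotBound; positivity
  have hC : 0 ≤ (1 + (Lf + Lg) * (2 / μ)) *
      ((ρf + ρg) * (2 / μ * lf) ^ 2 + 2 * Lf * (2 / μ * lf)) := by positivity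
  have hτ0 : 0 < σ / 2 := by positivity
  have hτ : σ / 2 ≤ σbar := by linarith
  rw [quotRate, add_mul]
  -- For `σ ≥ 1` the uniform gradient bound suffices, since a constant is at most that constant
  -- times `σ`; this keeps the rate independent of `σbar`.
  rcases le_total σ 1 with h1 | h1
  · refine le_trans ?_ (le_add_of_nonneg_right (by positivity))
    obtain ⟨y, hy⟩ := A.penaltySol_nonempty (x := x) hτ0.le hτ
    obtain ⟨yp, hyp, hep⟩ := A.exists_penaltySol_near_penaltySol hμ h0.le hσ hy
    obtain ⟨ym, hym, hem⟩ := A.exists_penaltySol_near_penaltySol hμ le_rfl (h0.le.trans hσ) hy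
    have hym' := hym
    rw [penaltySol_zero] at hym'
    rw [(A.hasGradientAt_penaltyQuot hμ h0 hσ hyp hym').gradient,
      (A.hasGradientAt_penaltyQuot hμ hτ0 hτ hy hym').gradient]
    rw [sub_half, abs_of_pos hτ0] at hep
    rw [zero_sub, abs_neg, abs_of_pos hτ0] at hem
    have h2 : 2 * (σ / 2) = σ := by ring
    have h := A.norm_gradFst_second_difference_le hμ hτ0 (by linarith) (by linarith) hy
      (by rwa [h2]) hym hep hem
    rw [h2] at h
    simp only [gradFst_penalty A.gradient_f.1 A.gradient_g.1] at h
    calc _ = ‖σ⁻¹ • (σ • gradFst f x yp + gradFst g x yp -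
            ((σ / 2) • gradFst f x y + gradFst g x y) -
            ((σ / 2) • gradFst f x y + gradFst g x y) +
            ((0 : ℝ) • gradFst f x ym + gradFst g x ym))‖ := by
          congr 1
          match_scalars <;> field_simp <;> ring
      _ ≤ σ⁻¹ * ((1 + (Lf + Lg) * (2 / μ)) * ((ρf + ρg) * (2 / μ * lf * (σ / 2)) ^ 2 +
            2 * Lf * (σ / 2) * (2 / μ * lf * (σ / 2)))) := by
          rw [norm_smul, norm_inv, Real.norm_of_nonneg h0.le]
          gcongr
      _ = (1 + (Lf + Lg) * (2 / μ)) *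
            ((ρf + ρg) * (2 / μ * lf) ^ 2 + 2 * Lf * (2 / μ * lf)) * (σ / 4) := by
          field_simp
          ring
      _ ≤ _ := by gcongr; linarith
  · refine le_trans ?_ (le_add_of_nonneg_left (by positivity))
    have ha := A.norm_gradient_penaltyQuot_le hμ h0 hσ x
    have hb := A.norm_gradient_penaltyQuot_le hμ hτ0 hτ x
    refine (norm_sub_le _ _).trans ?_
    nlinarith

/-! ### The limit as the penalty parameter tends to zero -/

/-- `lowerSol g x` may be unbounded, so the minimizer is found as a limit point of penalty
minimizers, which can be chosen in a fixed ball. Each has an `f`-value no larger than any on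
`lowerSol g x`. -/
theorem exists_isMinOn_lowerSol (hμ : 0 < μ) (h0 : 0 < σ) (hσ : σ ≤ σbar) (x : Euc dx) :
    ∃ z ∈ lowerSol g x, ∀ y ∈ lowerSol g x, f x z ≤ f x y := by
  obtain ⟨y, hy⟩ := A.penaltySol_nonempty (x := x) h0.le hσ
  set s : ℕ → ℝ := fun k => σ / 2 ^ k with hs
  have hs0 : ∀ k, 0 < s k := fun k => by positivity
  have hsσ : ∀ k, s k ≤ σ := fun k => div_le_self h0.le (one_le_pow₀ one_le_two)
  have hslim : Filter.Tendsto s Filter.atTop (nhds 0) :=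
    tendsto_const_nhds.div_atTop (tendsto_pow_atTop_atTop_of_one_lt one_lt_two)
  choose w hw hwy using fun k =>
    A.exists_penaltySol_near_penaltySol hμ (hs0 k).le ((hsσ k).trans hσ) hy
  obtain ⟨z, -, n, hn, hlim⟩ := (isCompact_closedBall y (2 / μ * lf * σ)).tendsto_subseq
    (x := w) fun k => by
      rw [mem_closedBall_iff_norm]
      refine (hwy k).trans ?_
      gcongr
      rw [abs_le]
      constructor <;> linarith [hsσ k, hs0 k]
  have hslim' := hslim.comp hn.tendsto_atTop
  have hf := (differentiable_of_joint A.gradient_f.1 x).continuous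
  have hg := (differentiable_of_joint A.gradient_g.1 x).continuous
  have hfz := (hf.tendsto z).comp hlim
  have hgz := (hg.tendsto z).comp hlim
  have hz : z ∈ lowerSol g x := fun y' => by
    have hl := (hslim'.mul hfz).add hgz
    have hr := (hslim'.mul_const (f x y')).add_const (g x y')
    have := le_of_tendsto_of_tendsto' hl hr fun k => hw (n k) y'
    simpa using this
  refine ⟨z, hz, fun y' hy' => ?_⟩
  refine le_of_tendsto' hfz fun k => ?_
  have h1 : s (n k) * f x (w (n k)) + g x (w (n k)) ≤ s (n k) * f x y' + g x y' := hw (n k) y'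
  have h2 := hy' (w (n k))
  have h3 : s (n k) * f x (w (n k)) ≤ s (n k) * f x y' := by linarith
  exact le_of_mul_le_mul_left h3 (hs0 (n k))

theorem isLeast_hyperObj (hμ : 0 < μ) (h0 : 0 < σ) (hσ : σ ≤ σbar) (x : Euc dx) :
    IsLeast (f x '' lowerSol g x) (hyperObj f g x) := by
  obtain ⟨z, hz, hmin⟩ := A.exists_isMinOn_lowerSol hμ h0 hσ x
  have h : IsLeast (f x '' lowerSol g x) (f x z) :=
    ⟨⟨z, hz, rfl⟩, by rintro _ ⟨y, hy, rfl⟩; exact hmin y hy⟩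
  rw [hyperObj, h.csInf_eq]
  exact h

/-- Testing `g_σ` at an optimal lower-level solution gives `q_σ ≤ φ`; a lower-level solution within
`O(σ)` of a penalty minimizer gives the other side. -/
theorem abs_penaltyQuot_sub_hyperObj_le (hμ : 0 < μ) (h0 : 0 < σ) (hσ : σ ≤ σbar) (x : Euc dx) :
    |penaltyQuot f g σ x - hyperObj f g x| ≤ lf * (2 / μ * lf) * σ := by
  obtain ⟨⟨z, hz, hφ⟩, hlb⟩ := A.isLeast_hyperObj hμ h0 hσ x
  obtain ⟨y, hy⟩ := A.penaltySol_nonempty (x := x) h0.le hσ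
  obtain ⟨z', hz', hzy⟩ := A.exists_penaltySol_near_penaltySol hμ le_rfl (h0.le.trans hσ) hy
  rw [zero_sub, abs_neg, abs_of_pos h0] at hzy
  have hlip := abs_sub_le_of_lipschitz_joint A.lipschitz_f x z' y
  have hlip' : (lf : ℝ) * ‖z' - y‖ ≤ lf * (2 / μ * lf * σ) := by gcongr
  rw [penaltyQuot, penaltyVal_eq hy, penaltyVal_eq hz', inv_mul_eq_div]
  rw [penaltySol_zero] at hz'
  have h1 := hlb ⟨z', hz', rfl⟩
  have h2 : σ * f x y + g x y ≤ σ * f x z + g x z := hy z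
  have h3 := hz z'
  have h4 := hz' y
  have h5 := abs_le.1 (hlip.trans hlip')
  simp only [penalty, zero_mul, zero_add]
  rw [abs_le]
  constructor
  · rw [le_sub_iff_add_le, le_div_iff₀ h0]
    nlinarith
  · have : (σ * f x y + g x y - g x z') / σ ≤ hyperObj f g x := by
      rw [div_le_iff₀ h0, ← hφ]
      linarith
    have h6 : 0 ≤ lf * (2 / μ * lf) * σ := by positivity
    linarith

theorem hasGradientAt_hyperObj (hμ : 0 < μ) (h0 : 0 < σ) (hσ : σ ≤ σbar) (x : Euc dx) :
    ∃ G, HasGradientAt (hyperObj f g) G x ∧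
      ‖G - gradient (penaltyQuot f g σ) x‖ ≤ 2 * quotRate μ lf Lf Lg ρf ρg * σ := by
  -- The factor 2 is the sum of the geometric series of halving steps.
  set C := 2 * quotRate μ lf Lf Lg ρf ρg * σ
  set s : ℕ → ℝ := fun k => σ / 2 ^ k with hs
  have hs0 : ∀ k, 0 < s k := fun k => by positivity
  have hsσ : ∀ k, s k ≤ σbar := fun k =>
    (div_le_self h0.le (one_le_pow₀ one_le_two)).trans hσ
  have hslim : Filter.Tendsto s Filter.atTop (nhds 0) :=
    tendsto_const_nhds.div_atTop (tendsto_pow_atTop_atTop_of_one_lt one_lt_two)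
  set D : ℕ → Euc dx → Euc dx := fun k x => gradient (penaltyQuot f g (s k)) x with hD
  have hstep : ∀ x k, dist (D k x) (D (k + 1) x) ≤ C / 2 / 2 ^ k := fun x k => by
    have h := A.norm_gradient_penaltyQuot_sub_le hμ (hs0 k) (hsσ k) x
    have hsk : s k / 2 = s (k + 1) := by simp only [hs]; ring
    rw [hsk] at h
    rw [dist_eq_norm]
    refine h.trans_eq ?_
    simp only [C, hs]
    ring
  choose G hG using fun x => cauchySeq_tendsto_of_complete (cauchySeq_of_le_geometric_two (hstep x))
  have hdist : ∀ k x, dist (D k x) (G x) ≤ C / 2 ^ k := fun k x =>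
    dist_le_of_le_geometric_two_of_tendsto (hstep x) (hG x) k
  have hunif : TendstoUniformly (fun k x => InnerProductSpace.toDual ℝ (Euc dx) (D k x))
      (fun x => InnerProductSpace.toDual ℝ (Euc dx) (G x)) Filter.atTop := by
    rw [Metric.tendstoUniformly_iff]
    intro ε hε
    have hlim : Filter.Tendsto (fun k : ℕ => C / 2 ^ k) Filter.atTop (nhds 0) :=
      tendsto_const_nhds.div_atTop (tendsto_pow_atTop_atTop_of_one_lt one_lt_two)
    filter_upwards [hlim.eventually (gt_mem_nhds hε)] with k hk x
    rw [(InnerProductSpace.toDual ℝ (Euc dx)).dist_map, dist_comm]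
    exact (hdist k x).trans_lt hk
  refine ⟨G x, ?_, ?_⟩
  · rw [hasGradientAt_iff_hasFDerivAt]
    refine hasFDerivAt_of_tendstoUniformly hunif (f := fun k => penaltyQuot f g (s k))
      (fun k x => ?_) (fun x => ?_) x
    · obtain ⟨y, hy⟩ := A.penaltySol_nonempty (x := x) (hs0 k).le (hsσ k)
      obtain ⟨z, hz⟩ := A.penaltySol_nonempty (x := x) le_rfl (h0.le.trans hσ)
      rw [penaltySol_zero] at hz
      exact (A.hasGradientAt_penaltyQuot hμ (hs0 k) (hsσ k) hy
        hz).differentiableAt.hasGradientAt.hasFDerivAt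
    · rw [tendsto_iff_norm_sub_tendsto_zero]
      refine squeeze_zero (fun _ => norm_nonneg _)
        (fun k => A.abs_penaltyQuot_sub_hyperObj_le hμ (hs0 k) (hsσ k) x) ?_
      simpa using hslim.const_mul (lf * (2 / μ * lf))
  · have h := hdist 0 x
    rw [dist_comm, dist_eq_norm] at h
    simpa [hD, hs] using h

theorem norm_gradient_penaltyQuot_sub_hyperGradEst_le (hμ : 0 < μ) (h0 : 0 < σ) (hσ : σ ≤ σbar)
    (x : Euc dx) (yhat zhat : Euc dy) :
    ‖gradient (penaltyQuot f g σ) x - hyperGradEst f g σ x yhat zhat‖ ≤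
      Lf * Metric.infDist yhat (penaltySol f g σ x) +
        Lg / σ * Metric.infDist yhat (penaltySol f g σ x) +
        Lg / σ * Metric.infDist zhat (lowerSol g x) := by
  have hzne : (lowerSol g x).Nonempty :=
    penaltySol_zero f g x ▸ A.penaltySol_nonempty le_rfl (h0.le.trans hσ)
  obtain ⟨y, hy, hyd⟩ := (isClosed_argminSet (differentiable_penalty A.gradient_f.1
    A.gradient_g.1 σ x).continuous).exists_infDist_eq_dist
      (A.penaltySol_nonempty (x := x) h0.le hσ) yhat
  obtain ⟨z, hz, hzd⟩ := (isClosed_argminSet (differentiable_of_joint A.gradient_g.1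
    x).continuous).exists_infDist_eq_dist hzne zhat
  have hyd' : Metric.infDist yhat (penaltySol f g σ x) = ‖y - yhat‖ := by
    rw [← dist_eq_norm, dist_comm]; exact hyd
  have hzd' : Metric.infDist zhat (lowerSol g x) = ‖z - zhat‖ := by
    rw [← dist_eq_norm, dist_comm]; exact hzd
  rw [(A.hasGradientAt_penaltyQuot hμ h0 hσ hy hz).gradient, hyd', hzd', div_mul_eq_mul_div,
    div_mul_eq_mul_div, ← inv_mul_eq_div, ← inv_mul_eq_div]
  change ‖_ - (gradFst f x yhat + σ⁻¹ • (gradFst g x yhat - gradFst g x zhat))‖ ≤ _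
  calc _ = ‖(gradFst f x y - gradFst f x yhat) + σ⁻¹ • (gradFst g x y - gradFst g x yhat) -
        σ⁻¹ • (gradFst g x z - gradFst g x zhat)‖ := by congr 1; module
    _ ≤ _ := by
      refine norm_sub_le_of_le (norm_add_le_of_le (A.gradient_f.gradFst_sub_le x y yhat) ?_) ?_
      all_goals
        rw [norm_smul, norm_inv, Real.norm_of_nonneg h0.le]
        gcongr
        exact A.gradient_g.gradFst_sub_le x _ _

end BilevelAssumption

end Bilevel

theorem lemma1 (μ : ℝ) (hμ : 0 < μ) (lf Lf Lg ρf ρg : ℝ≥0) :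
    ∃ Cbar : ℝ, 0 ≤ Cbar ∧
      ∀ (dx dy : ℕ) (f g : Euc dx → Euc dy → ℝ) (σbar : ℝ),
        BilevelAssumption μ σbar lf Lf Lg ρf ρg f g →
        ∀ σ : ℝ, 0 < σ → σ ≤ σbar → σ * ρf ≤ ρg →
        ∀ x : Euc dx,
          IsLeast (f x '' lowerSol g x) (hyperObj f g x) ∧
          DifferentiableAt ℝ (hyperObj f g) x ∧
          (penaltySol f g σ x).Nonempty ∧
          ∀ yhat zhat : Euc dy,
            ‖gradient (hyperObj f g) x - hyperGradEst f g σ x yhat zhat‖ ≤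
              Cbar * σ +
                (Lf * Metric.infDist yhat (penaltySol f g σ x) +
                  Lg / σ * Metric.infDist yhat (penaltySol f g σ x) +
                  Lg / σ * Metric.infDist zhat (lowerSol g x)) := by
  refine ⟨2 * quotRate μ lf Lf Lg ρf ρg, by unfold quotRate quotBound; positivity, ?_⟩
  intro dx dy f g σbar A σ h0 hσ _ x
  obtain ⟨G, hG, hGle⟩ := A.hasGradientAt_hyperObj hμ h0 hσ x
  refine ⟨A.isLeast_hyperObj hμ h0 hσ x, hG.differentiableAt,
    A.penaltySol_nonempty h0.le hσ, fun yhat zhat => ?_⟩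
  rw [hG.gradient, ← sub_add_sub_cancel _ (gradient (penaltyQuot f g σ) x)]
  exact norm_add_le_of_le hGle
    (A.norm_gradient_penaltyQuot_sub_hyperGradEst_le hμ h0 hσ x yhat zhat)
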